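/- Let $n\ge 3$ and let $P\subset\mathbb{R}^3$ be a convex polygon lying in a plane that does not pass through the origin (for example, in the plane of height one $\{(x,y,z): z=1\}$), whose vertices (that is, extreme points) are exactly the $n$ distinct points $v_1,\dots,v_n$. The vertices need not be integral. Put $$\hat F_P(\phi)=\sum_{1\le i<j<k\le n}|\det(v_i,v_j,v_k)|\,\phi^i\phi^j\phi^k,\qquad \phi=(\phi^1,\dots,\phi^n)\in\mathbb{R}^n,$$ fix a real number $r>0$, let $$\Gamma_n=\Bigl\{\phi\in\mathbb{R}^n:\ \phi^i\ge 0\ (1\le i\le n),\ \sum_{i=1}^n\phi^i=r\Bigr\},$$ and let $F_P=\hat F_P|_{\Gamma_n}$. A point $\phi$ of the relative interior of $\Gamma_n$ is called a critical point of $F_P$ if the differential of $\hat F_P$ at $\phi$ vanishes on all vectors parallel to the affine hull of $\Gamma_n$. Then $F_P$ has exactly one critical point $\phi_*$ in the relative interior of $\Gamma_n$, and $\phi_*$ is the unique global maximum point of $F_P$ on $\Gamma_n$: $F_P(\psi)<F_P(\phi_*)$ for every $\psi\in\Gamma_n$ with $\psi\neq\phi_*$. -/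

import Mathlib

open scoped Matrix

/-- `P ⊂ ℝ³` is a (nondegenerate) convex polygon contained in a plane `{x | ℓ x = c}`, `c ≠ 0`,
not passing through the origin, and `v 0, …, v (n-1)` is a list without repetitions of all its
vertices, that is, of its extreme points. The order in which they are listed is arbitrary. -/
structure IsConvexPolygonWithVertices {n : ℕ} (P : Set (Fin 3 → ℝ)) (v : Fin n → Fin 3 → ℝ) :
    Prop where
  three_le : 3 ≤ n
  injective : Function.Injective v
  eq_convexHull : P = convexHull ℝ (Set.range v)
  extremePoints_eq : Set.extremePoints ℝ P = Set.range v
  exists_plane : ∃ (ℓ : (Fin 3 → ℝ) →ₗ[ℝ] ℝ) (c : ℝ), c ≠ 0 ∧ ∀ x ∈ P, ℓ x = c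

/-- The determinant of the `3 × 3` matrix with columns `u`, `v`, `w`. -/
def det3 (u v w : Fin 3 → ℝ) : ℝ := (Matrix.of ![u, v, w])ᵀ.det

/-- The cubic `∑_{i<j<k} |det(vᵢ, vⱼ, vₖ)| φᵢ φⱼ φₖ`. -/
def cubicF {n : ℕ} (v : Fin n → Fin 3 → ℝ) (φ : Fin n → ℝ) : ℝ :=
  ∑ i, ∑ j ∈ Finset.Ioi i, ∑ k ∈ Finset.Ioi j, |det3 (v i) (v j) (v k)| * φ i * φ j * φ k

/-- The simplex `{φ ≥ 0, ∑ᵢ φᵢ = r}`. -/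
def simplexGamma (n : ℕ) (r : ℝ) : Set (Fin n → ℝ) :=
  {φ | (∀ i, 0 ≤ φ i) ∧ ∑ i, φ i = r}

/-- `φ`, a point of the relative interior of `C`, is a critical point of the restriction of `f`
to `C`: the differential of `f` at `φ` vanishes on all directions of the affine hull of `C`. -/
def IsCriticalPointInRelint {n : ℕ} (f : (Fin n → ℝ) → ℝ) (C : Set (Fin n → ℝ))
    (φ : Fin n → ℝ) : Prop :=
  φ ∈ intrinsicInterior ℝ C ∧
    ∃ f' : (Fin n → ℝ) →L[ℝ] ℝ, HasFDerivAt f f' φ ∧ ∀ w ∈ (affineSpan ℝ C).direction, f' w = 0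

/-!
The cubic is the volume of the zonotope `∑ [0, φ i • v i]`, and its polarization `polarF` is, up to a
factor, a mixed volume.

*Uniqueness.* The point is that the Hessian `polarF v φ` at a positive `φ` is negative definite on
the complement of `φ` (`polarF_neg`), a strict Alexandrov–Fenchel inequality. Fixing one index `x`
gives the area form of the projection along `v x`, which in suitable coordinates is
`∑ c i * c j * |σ i - σ j| * w i * w j` with distinct `σ`; since `|s - t|` is conditionally negative
definite, this form satisfies a reverse Cauchy–Schwarz inequality. Summing these inequalities over
`x` gives, for the eigenvalues `μ` of the Hessian suitably normalized so that `φ` has eigenvalue `1`,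
the bound `μ ≤ μ ^ 2`. The Perron–Frobenius theorem says that `1` is the largest eigenvalue and is
simple, so all others are negative (`neg_def_of_bochner`). Two distinct critical points `φ`, `ψ` would
then give both `polarF v φ ψ ψ < polarF v φ φ φ = polarF v φ φ ψ` and the same with `φ` and `ψ`
exchanged, which is absurd. This part needs only that no three of the `v i` are collinear.

*Existence.* A maximum point exists by compactness, and it remains to see that it has no zero
coordinate (`pos_of_isMaxOn`). This is where convex position enters. Up to a factor, the gradient at
`φ` is the restriction to the vertices of the convex function
`g y = ∑ |det3 y (v j) (v k)| * φ j * φ k`. At a maximum point `g` has a constant value on the vertices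
in the support of `φ` and is not larger at the others. If `v x` is outside the support and `a`, `b` are
its neighbours there, `g` is constant on the segment `ab`, at most equal to that constant on the hull
of the support, and has a kink along `ab`, and so it is strictly larger at `v x`, which is impossible.
Hence every maximum point is an interior critical point, and the uniqueness of the latter makes the
maximum strict.
-/

/-! ### Conditionally negative definite forms on the line -/

/-- Adding a point `t` of mass `-∑ a` to the right of all `σ i` makes the total mass zero, and the
inequality says that the form `∑ |σ i - σ j| a i a j` of the enlarged configuration is nonpositive.
The induction adds the points from left to right: passing from `σ m` to `t` changes the difference
of the two sides by `2 * (t - σ m) * (∑ a) ^ 2`. -/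
theorem sum_abs_sub_le_aux {ι : Type*} [DecidableEq ι] (σ a : ι → ℝ) (s : Finset ι) :
    Set.InjOn σ s → ∀ t, (∀ i ∈ s, σ i < t) →
      (∑ i ∈ s, ∑ j ∈ s, |σ i - σ j| * a i * a j ≤
          2 * (∑ i ∈ s, a i) * ∑ i ∈ s, (t - σ i) * a i) ∧
      (∑ i ∈ s, ∑ j ∈ s, |σ i - σ j| * a i * a j =
          2 * (∑ i ∈ s, a i) * ∑ i ∈ s, (t - σ i) * a i → ∀ i ∈ s, a i = 0) := by
  induction s using Finset.induction_on_max_value σ with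
  | empty => simp
  | insert m s hm hmax ih =>
    intro hinj t ht
    have hlt : ∀ i ∈ s, σ i < σ m := fun i hi =>
      lt_of_le_of_ne (hmax i hi) fun h => hm <| by
        have := hinj (Finset.mem_coe.2 (Finset.mem_insert_of_mem hi))
          (Finset.mem_coe.2 (Finset.mem_insert_self m s)) h
        exact this ▸ hi
    obtain ⟨h1, h2⟩ := ih (hinj.mono (by simp)) (σ m) hlt
    have hmt : 0 < t - σ m := sub_pos.2 (ht m (Finset.mem_insert_self m s))
    have e1 : ∑ i ∈ s, |σ i - σ m| * a i * a m = (∑ i ∈ s, (σ m - σ i) * a i) * a m := by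
      rw [Finset.sum_mul]
      refine Finset.sum_congr rfl fun i hi => ?_
      rw [abs_of_neg (by linarith [hlt i hi])]; ring
    have e2 : ∑ i ∈ s, |σ m - σ i| * a m * a i = (∑ i ∈ s, (σ m - σ i) * a i) * a m := by
      rw [Finset.sum_mul]
      refine Finset.sum_congr rfl fun i hi => ?_
      rw [abs_of_pos (by linarith [hlt i hi])]; ring
    have e3 : ∑ i ∈ s, (t - σ i) * a i =
        ∑ i ∈ s, (σ m - σ i) * a i + (t - σ m) * ∑ i ∈ s, a i := by
      rw [Finset.mul_sum, ← Finset.sum_add_distrib]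
      exact Finset.sum_congr rfl fun i _ => by ring
    simp only [Finset.sum_insert hm, Finset.sum_add_distrib, sub_self, abs_zero, e1, e2, e3]
    set A := ∑ i ∈ s, a i
    set B := ∑ i ∈ s, (σ m - σ i) * a i
    set Q := ∑ i ∈ s, ∑ j ∈ s, |σ i - σ j| * a i * a j
    have key : 2 * (a m + A) * ((t - σ m) * a m + (B + (t - σ m) * A)) =
        0 * a m * a m + B * a m + (B * a m + Q) + (2 * A * B - Q)
          + 2 * ((t - σ m) * (a m + A) ^ 2) := by ring
    have hsq := mul_nonneg hmt.le (sq_nonneg (a m + A))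
    refine ⟨by linarith, fun h => ?_⟩
    have h3 : (t - σ m) * (a m + A) ^ 2 = 0 := by linarith
    have h4 : a m + A = 0 := by simpa [hmt.ne'] using h3
    have h5 := h2 (by linarith)
    have h6 : A = 0 := Finset.sum_eq_zero h5
    intro i hi
    rcases Finset.mem_insert.1 hi with rfl | hi
    · linarith
    · exact h5 i hi

/-- The kernel `|s - t|` is conditionally negative definite on the real line. -/
theorem sum_abs_sub_nonpos {ι : Type*} [DecidableEq ι] (σ a : ι → ℝ) (s : Finset ι)
    (hσ : Set.InjOn σ s) (ha : ∑ i ∈ s, a i = 0) :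
    ∑ i ∈ s, ∑ j ∈ s, |σ i - σ j| * a i * a j ≤ 0 ∧
      (∑ i ∈ s, ∑ j ∈ s, |σ i - σ j| * a i * a j = 0 → ∀ i ∈ s, a i = 0) := by
  obtain ⟨t, ht⟩ : ∃ t, ∀ i ∈ s, σ i < t := by
    obtain ⟨t, ht⟩ := (s.image σ).bddAbove
    exact ⟨t + 1, fun i hi => by
      have := ht (Finset.mem_coe.2 (Finset.mem_image_of_mem σ hi)); linarith⟩
  simpa [ha] using sum_abs_sub_le_aux σ a s hσ t ht

/-- A form with matrix `c i * c j * |σ i - σ j|` is negative definite, in the variables with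
`c i ≠ 0`, on the hyperplane `∑ c i * x i = 0`; hence it is also negative definite on the orthogonal
complement, for the form itself, of any vector on which it is positive. -/
theorem lorentzian_of_abs_sub {ι : Type*} [Fintype ι] [DecidableEq ι]
    {A : Matrix ι ι ℝ} {c σ : ι → ℝ} (hc : ∀ i, 0 ≤ c i)
    (hσ : Set.InjOn σ {i | c i ≠ 0}) (hA : ∀ i j, A i j = c i * c j * |σ i - σ j|)
    {φ w : ι → ℝ} (hφ : ∀ i, 0 < φ i) (hφA : 0 < φ ⬝ᵥ A *ᵥ φ) (hw : φ ⬝ᵥ A *ᵥ w = 0) :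
    w ⬝ᵥ A *ᵥ w ≤ 0 ∧ (w ⬝ᵥ A *ᵥ w = 0 → ∀ i, c i ≠ 0 → w i = 0) := by
  have hAs : Aᵀ = A := by
    ext i j; rw [Matrix.transpose_apply, hA, hA, abs_sub_comm]; ring
  set s : Finset ι := Finset.univ.filter fun i => c i ≠ 0 with hs
  have hform : ∀ x : ι → ℝ, x ⬝ᵥ A *ᵥ x =
      ∑ i ∈ s, ∑ j ∈ s, |σ i - σ j| * (c i * x i) * (c j * x j) := by
    intro x
    simp only [dotProduct, Matrix.mulVec, Finset.mul_sum, hs, Finset.sum_filter]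
    refine Finset.sum_congr rfl fun i _ => ?_
    split_ifs with hi
    · refine Finset.sum_congr rfl fun j _ => ?_
      split_ifs with hj
      · rw [hA]; ring
      · rw [hA]; simp [not_not.1 hj]
    · refine Finset.sum_eq_zero fun j _ => ?_
      rw [hA]; simp [not_not.1 hi]
  have hpos : 0 < ∑ i ∈ s, c i * φ i := by
    refine Finset.sum_pos (fun i hi => mul_pos ?_ (hφ i)) ?_
    · exact lt_of_le_of_ne (hc i) (Ne.symm (Finset.mem_filter.1 hi).2)
    · by_contra h
      rw [Finset.not_nonempty_iff_eq_empty] at h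
      rw [hform, h] at hφA; simp at hφA
  -- correct `w` by the multiple of `φ` that brings it into the hyperplane `∑ c i * y i = 0`
  set k := (∑ i ∈ s, c i * w i) / ∑ i ∈ s, c i * φ i with hk
  set y := w - k • φ with hy
  have hy0 : ∑ i ∈ s, c i * y i = 0 := by
    have : ∑ i ∈ s, c i * y i = ∑ i ∈ s, c i * w i - k * ∑ i ∈ s, c i * φ i := by
      rw [Finset.mul_sum, ← Finset.sum_sub_distrib]
      exact Finset.sum_congr rfl fun i _ => by simp [hy]; ring
    rw [this, hk]; field_simp; ring
  obtain ⟨h1, h2⟩ := sum_abs_sub_nonpos σ (fun i => c i * y i) s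
    (hσ.mono fun i hi => by simpa [hs] using hi) hy0
  rw [← hform] at h1 h2
  have hw' : w ⬝ᵥ A *ᵥ φ = 0 := by
    rw [Matrix.dotProduct_mulVec, ← Matrix.mulVec_transpose, hAs, dotProduct_comm, hw]
  have hexp : y ⬝ᵥ A *ᵥ y = w ⬝ᵥ A *ᵥ w + k ^ 2 * (φ ⬝ᵥ A *ᵥ φ) := by
    simp only [hy, Matrix.mulVec_sub, Matrix.mulVec_smul, sub_dotProduct, dotProduct_sub,
      smul_dotProduct, dotProduct_smul, hw, hw', smul_eq_mul]
    ring
  have hk2 := mul_nonneg (sq_nonneg k) hφA.le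
  refine ⟨by linarith, fun h i hi => ?_⟩
  have h3 : k ^ 2 * (φ ⬝ᵥ A *ᵥ φ) = 0 := by linarith
  have h4 : k = 0 := by simpa [hφA.ne'] using h3
  have h5 := h2 (by rw [hexp, h, h4]; simp) i (by simpa [hs] using hi)
  simpa [hy, h4, hi] using h5

theorem reverse_cauchy_schwarz_of_abs_sub {ι : Type*} [Fintype ι] [DecidableEq ι]
    {A : Matrix ι ι ℝ} {c σ : ι → ℝ} (hc : ∀ i, 0 ≤ c i)
    (hσ : Set.InjOn σ {i | c i ≠ 0}) (hA : ∀ i j, A i j = c i * c j * |σ i - σ j|)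
    {φ : ι → ℝ} (hφ : ∀ i, 0 < φ i) (hφA : 0 < φ ⬝ᵥ A *ᵥ φ) (w : ι → ℝ) :
    w ⬝ᵥ A *ᵥ w ≤ (φ ⬝ᵥ A *ᵥ w) ^ 2 / (φ ⬝ᵥ A *ᵥ φ) := by
  have hAs : Aᵀ = A := by
    ext i j; rw [Matrix.transpose_apply, hA, hA, abs_sub_comm]; ring
  have hcomm : w ⬝ᵥ A *ᵥ φ = φ ⬝ᵥ A *ᵥ w := by
    rw [Matrix.dotProduct_mulVec, ← Matrix.mulVec_transpose, hAs, dotProduct_comm]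
  set q := φ ⬝ᵥ A *ᵥ φ
  set l := φ ⬝ᵥ A *ᵥ w
  have h := (lorentzian_of_abs_sub hc hσ hA hφ hφA (w := w - (l / q) • φ) (by
    simp only [Matrix.mulVec_sub, Matrix.mulVec_smul, dotProduct_sub, dotProduct_smul,
      smul_eq_mul]
    change l - l / q * q = 0
    field_simp; ring)).1
  simp only [Matrix.mulVec_sub, Matrix.mulVec_smul, sub_dotProduct, dotProduct_sub,
    smul_dotProduct, dotProduct_smul, smul_eq_mul, hcomm] at h
  change w ⬝ᵥ A *ᵥ w - l / q * l - l / q * (l - l / q * q) ≤ 0 at h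
  rw [div_mul_cancel₀ l hφA.ne', sub_self, mul_zero, sub_zero] at h
  have e : l ^ 2 / q = l / q * l := by ring
  rw [e]; linarith

/-! ### The Bochner method -/

/-- The Perron–Frobenius bound for the generalized eigenvalue problem `H w = μ (H φ / φ) w`: the
positive vector `φ` has eigenvalue `1`, every eigenvalue is at most `1`, and `1` is simple. The
difference of the two sides is a weighted sum of the squares `(w i * φ j - w j * φ i) ^ 2`. -/
theorem perron_bound {ι : Type*} [Fintype ι] {H : Matrix ι ι ℝ} (hH : ∀ i j, H i j = H j i)
    (hpos : ∀ i j, i ≠ j → 0 < H i j) {φ : ι → ℝ} (hφ : ∀ i, 0 < φ i) (w : ι → ℝ)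
    (hn : ∀ i, 0 ≤ H i i) :
    w ⬝ᵥ H *ᵥ w ≤ ∑ i, (H *ᵥ φ) i / φ i * w i ^ 2 ∧
      (w ⬝ᵥ H *ᵥ w = ∑ i, (H *ᵥ φ) i / φ i * w i ^ 2 → ∀ i j, w i * φ j = w j * φ i) := by
  have key : ∑ i, (H *ᵥ φ) i / φ i * w i ^ 2 - w ⬝ᵥ H *ᵥ w =
      ∑ i, ∑ j, H i j / (2 * φ i * φ j) * (w i * φ j - w j * φ i) ^ 2 := by
    have e1 : ∑ i, (H *ᵥ φ) i / φ i * w i ^ 2 =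
        ∑ i, ∑ j, H i j * φ j / φ i * w i ^ 2 := by
      simp only [Matrix.mulVec, dotProduct, Finset.sum_div, Finset.sum_mul]
    have e2 : ∑ i, (H *ᵥ φ) i / φ i * w i ^ 2 =
        ∑ i, ∑ j, H i j * φ i / φ j * w j ^ 2 := by
      rw [e1, Finset.sum_comm]
      exact Finset.sum_congr rfl fun i _ => Finset.sum_congr rfl fun j _ => by rw [hH]
    have e3 : w ⬝ᵥ H *ᵥ w = ∑ i, ∑ j, H i j * w i * w j := by
      simp only [Matrix.mulVec, dotProduct, Finset.mul_sum]
      exact Finset.sum_congr rfl fun i _ => Finset.sum_congr rfl fun j _ => by ring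
    have e4 : ∑ i, (H *ᵥ φ) i / φ i * w i ^ 2 = (∑ i, ∑ j, H i j * φ j / φ i * w i ^ 2 +
        ∑ i, ∑ j, H i j * φ i / φ j * w j ^ 2) / 2 := by rw [← e1, ← e2]; ring
    rw [e4, e3, ← Finset.sum_add_distrib, Finset.sum_div, ← Finset.sum_sub_distrib]
    refine Finset.sum_congr rfl fun i _ => ?_
    rw [← Finset.sum_add_distrib, Finset.sum_div, ← Finset.sum_sub_distrib]
    refine Finset.sum_congr rfl fun j _ => ?_
    have := (hφ i).ne'; have := (hφ j).ne'
    field_simp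
    ring
  have hH0 : ∀ i j, 0 ≤ H i j := fun i j => by
    rcases eq_or_ne i j with rfl | h
    exacts [hn i, (hpos i j h).le]
  have hterm : ∀ i j, 0 ≤ H i j / (2 * φ i * φ j) * (w i * φ j - w j * φ i) ^ 2 := fun i j => by
    have := hH0 i j; have := hφ i; have := hφ j
    positivity
  refine ⟨?_, fun h i j => ?_⟩
  · have := Finset.sum_nonneg fun i (_ : i ∈ Finset.univ) =>
      Finset.sum_nonneg fun j (_ : j ∈ Finset.univ) => hterm i j
    linarith
  · rcases eq_or_ne i j with rfl | hij
    · rfl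
    rw [h, sub_self] at key
    have h1 := (Finset.sum_eq_zero_iff_of_nonneg fun i _ =>
      Finset.sum_nonneg fun j _ => hterm i j).1 key.symm i (Finset.mem_univ _)
    have h2 := (Finset.sum_eq_zero_iff_of_nonneg fun j _ => hterm i j).1 h1 j (Finset.mem_univ _)
    have := hφ i; have := hφ j; have h3 := hpos i j hij
    have h4 : H i j / (2 * φ i * φ j) ≠ 0 := by positivity
    have h5 : w i * φ j - w j * φ i = 0 := by simpa [h4] using h2
    linarith

/-- The Bochner method. The hypothesis `hB` says that every eigenvalue `μ` of the problem
`H w = μ (H φ / φ) w` satisfies `μ ≤ μ ^ 2`, and `hker` excludes `μ = 0`. By the Perron–Frobenius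
bound every eigenvalue other than the simple eigenvalue `1` of `φ` is therefore negative, so that
`H` is negative definite on the complement of `φ`. -/
theorem neg_def_of_bochner {ι : Type*} [Fintype ι] [DecidableEq ι] [Nonempty ι]
    {H : Matrix ι ι ℝ} (hH : ∀ i j, H i j = H j i)
    (hn : ∀ i, 0 ≤ H i i) (hpos : ∀ i j, i ≠ j → 0 < H i j) {φ : ι → ℝ} (hφ : ∀ i, 0 < φ i)
    (hp : ∀ i, 0 < (H *ᵥ φ) i)
    (hB : ∀ w, w ⬝ᵥ H *ᵥ w ≤ ∑ i, φ i / (H *ᵥ φ) i * (H *ᵥ w) i ^ 2)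
    (hker : ∀ w, H *ᵥ w = 0 → w = 0) {w : ι → ℝ} (hw : φ ⬝ᵥ H *ᵥ w = 0) (hw0 : w ≠ 0) :
    w ⬝ᵥ H *ᵥ w < 0 := by
  set p := H *ᵥ φ with hpdef
  -- conjugating by `d` turns the generalized eigenvalue problem into one for a symmetric matrix
  set d : ι → ℝ := fun i => √(φ i / p i) with hd
  have hd0 : ∀ i, 0 < d i := fun i => Real.sqrt_pos.2 (div_pos (hφ i) (hp i))
  have hd2 : ∀ i, d i * d i = φ i / p i := fun i =>
    Real.mul_self_sqrt (div_pos (hφ i) (hp i)).le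
  set M : Matrix ι ι ℝ := Matrix.of fun i j => d i * H i j * d j with hM
  have hMh : M.IsHermitian := by
    ext i j; simp [hM, Matrix.conjTranspose_apply, hH j i]; ring
  have hMv : ∀ y : ι → ℝ, M *ᵥ y = fun i => d i * (H *ᵥ fun j => d j * y j) i := by
    intro y; ext i
    simp only [hM, Matrix.mulVec, dotProduct, Matrix.of_apply, Finset.mul_sum]
    exact Finset.sum_congr rfl fun j _ => by ring
  set b := hMh.eigenvectorBasis
  set μ := hMh.eigenvalues
  -- an eigenvector whose eigenvalue is not negative is proportional to `φ`
  have heig : ∀ k, 0 ≤ μ k → ∀ i j, (d i * b k i) * φ j = (d j * b k j) * φ i := by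
    intro k hk
    set x : ι → ℝ := fun i => d i * b k i with hx
    have hHx : ∀ i, (H *ᵥ x) i = μ k * (p i / φ i * x i) := by
      intro i
      have h1 := congrFun (hMh.mulVec_eigenvectorBasis k) i
      rw [hMv] at h1
      simp only [Pi.smul_apply, smul_eq_mul] at h1
      have h2 : d i * (H *ᵥ x) i = d i * (μ k * (p i / φ i * x i)) := by
        have h3 : d i * (μ k * (p i / φ i * x i)) = μ k * (b k i) * (d i * d i * (p i / φ i)) := by
          rw [hx]; ring
        rw [h3, hd2]
        have h4 : φ i / p i * (p i / φ i) = 1 := by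
          have := (hφ i).ne'; have := (hp i).ne'
          field_simp
        rw [h4, mul_one]; exact h1
      exact mul_left_cancel₀ (hd0 i).ne' h2
    have hx0 : x ≠ 0 := by
      intro h
      apply b.orthonormal.ne_zero k
      ext i
      have := congrFun h i
      simpa [hx, (hd0 i).ne'] using this
    set N := ∑ i, p i / φ i * x i ^ 2 with hN
    have hNpos : 0 < N := by
      obtain ⟨i, hi⟩ := Function.ne_iff.1 hx0
      refine Finset.sum_pos' (fun j _ => ?_) ⟨i, Finset.mem_univ _, ?_⟩
      · have := hp j; have := hφ j; positivity
      · have := hp i; have := hφ i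
        have : x i ≠ 0 := hi
        positivity
    have hxHx : x ⬝ᵥ H *ᵥ x = μ k * N := by
      simp only [dotProduct, hHx, hN, Finset.mul_sum]
      exact Finset.sum_congr rfl fun i _ => by ring
    have h1 := hB x
    have h2 : ∑ i, φ i / p i * (H *ᵥ x) i ^ 2 = μ k ^ 2 * N := by
      simp only [hHx, hN, Finset.mul_sum]
      refine Finset.sum_congr rfl fun i _ => ?_
      have := (hφ i).ne'; have := (hp i).ne'
      field_simp
    rw [hxHx, h2] at h1
    obtain ⟨h3, h4⟩ := perron_bound hH hpos hφ x hn
    have hk0 : μ k ≠ 0 := fun h => hx0 (hker x (by ext i; simp [hHx, h]))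
    have hk1 : 0 < μ k := lt_of_le_of_ne hk hk0.symm
    rw [hxHx] at h3 h4
    have hμ1 : 1 ≤ μ k := by
      have : μ k * N * 1 ≤ μ k * N * μ k := by nlinarith
      exact le_of_mul_le_mul_left this (by positivity)
    have hμ2 : μ k ≤ 1 := by
      have : μ k * N ≤ 1 * N := by rw [one_mul]; exact h3
      exact le_of_mul_le_mul_right this hNpos
    exact h4 (by rw [le_antisymm hμ2 hμ1, one_mul])
  set y : EuclideanSpace ℝ ι := WithLp.toLp 2 fun i => w i / d i with hy
  have hdy : (fun j => d j * y j) = w := by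
    ext j; simp [hy]; have := (hd0 j).ne'; field_simp
  have hφw : ∑ i, p i * w i = 0 := by
    have h1 : p ⬝ᵥ w = φ ⬝ᵥ H *ᵥ w := by
      rw [Matrix.dotProduct_mulVec, ← Matrix.mulVec_transpose,
        show Hᵀ = H from by ext i j; exact hH j i]
    exact h1.trans hw
  have horth : ∀ k, 0 ≤ μ k → inner ℝ (b k) y = 0 := by
    intro k hk
    have h := heig k hk
    obtain ⟨j⟩ := ‹Nonempty ι›
    have e : ∀ i, y i * b k i = (d j * b k j) / φ j * (p i * w i) := by
      intro i
      have h1 := h i j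
      have h2 := hd2 i
      have := (hφ i).ne'; have := (hφ j).ne'; have := (hp i).ne'; have := (hd0 i).ne'
      have h3 : b k i = d j * b k j * φ i / (φ j * d i) := by
        field_simp; linarith
      have h4 : φ i = d i * d i * p i := by rw [h2]; field_simp
      simp only [hy, h3]
      rw [h4]
      field_simp
    rw [PiLp.inner_apply]
    simp only [RCLike.inner_apply, conj_trivial]
    rw [Finset.sum_congr rfl fun i _ => e i, ← Finset.mul_sum, hφw, mul_zero]
  have hq : w ⬝ᵥ H *ᵥ w = ∑ k, μ k * (inner ℝ (b k) y) ^ 2 := by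
    have h1 : w ⬝ᵥ H *ᵥ w = inner ℝ (WithLp.toLp 2 (M *ᵥ y)) y := by
      rw [PiLp.inner_apply]
      simp only [RCLike.inner_apply, conj_trivial, hMv, hdy, dotProduct]
      refine Finset.sum_congr rfl fun i _ => ?_
      have := (hd0 i).ne'
      simp only [hy]; field_simp
    rw [h1, ← b.sum_inner_mul_inner]
    refine Finset.sum_congr rfl fun k _ => ?_
    have h2 : inner ℝ (WithLp.toLp 2 (M *ᵥ y) : EuclideanSpace ℝ ι) (b k) =
        μ k * inner ℝ (b k) y := by
      have h3 : ∀ u z : EuclideanSpace ℝ ι, inner ℝ u z = (u : ι → ℝ) ⬝ᵥ (z : ι → ℝ) := by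
        intro u z; simp [PiLp.inner_apply, dotProduct, mul_comm]
      rw [h3, h3]
      change (M *ᵥ (y : ι → ℝ)) ⬝ᵥ (b k : ι → ℝ) = _
      rw [dotProduct_comm, Matrix.dotProduct_mulVec, ← Matrix.mulVec_transpose,
        ← Matrix.conjTranspose_eq_transpose_of_trivial M, hMh.eq,
        hMh.mulVec_eigenvectorBasis, smul_dotProduct, smul_eq_mul]
    rw [h2]; ring
  have hterm : ∀ k, μ k * (inner ℝ (b k) y) ^ 2 ≤ 0 := fun k => by
    rcases le_or_gt 0 (μ k) with h | h
    · rw [horth k h]; simp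
    · exact mul_nonpos_of_nonpos_of_nonneg h.le (sq_nonneg _)
  have hy0 : y ≠ 0 := by
    intro h
    apply hw0
    rw [← hdy, h]; ext j; simp
  obtain ⟨k, hk⟩ : ∃ k, inner ℝ (b k) y ≠ (0 : ℝ) := by
    by_contra! h
    have h1 := b.sum_inner_mul_inner y y
    simp only [h, mul_zero, Finset.sum_const_zero] at h1
    exact hy0 (inner_self_eq_zero.1 h1.symm)
  have hμk : μ k < 0 := by
    by_contra! h
    exact hk (horth k h)
  rw [hq]
  refine Finset.sum_neg' (fun i _ => hterm i) ⟨k, Finset.mem_univ _, ?_⟩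
  exact mul_neg_of_neg_of_pos hμk (by positivity)

/-! ### Determinants and polygons -/

theorem det3_eq (u v w : Fin 3 → ℝ) : det3 u v w =
    u 0 * v 1 * w 2 - u 0 * v 2 * w 1 - u 1 * v 0 * w 2 + u 1 * v 2 * w 0 + u 2 * v 0 * w 1
      - u 2 * v 1 * w 0 := by
  simp [det3, Matrix.det_fin_three]

theorem det3_swap_left (u v w : Fin 3 → ℝ) : det3 v u w = -det3 u v w := by
  simp only [det3_eq]; ring

theorem det3_swap_right (u v w : Fin 3 → ℝ) : det3 u w v = -det3 u v w := by
  simp only [det3_eq]; ring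

/-- Cramer's rule: the linear relation between four vectors of `ℝ³`. -/
theorem det3_relation (x y z u : Fin 3 → ℝ) :
    det3 y z u • x - det3 x z u • y + det3 x y u • z - det3 x y z • u = 0 := by
  ext i
  fin_cases i <;> simp [det3_eq] <;> ring

theorem det3_add_smul (α β : ℝ) (a b y z : Fin 3 → ℝ) :
    det3 (α • a + β • b) y z = α * det3 a y z + β * det3 b y z := by
  simp [det3_eq]; ring

theorem det3_self_left (u v : Fin 3 → ℝ) : det3 u u v = 0 := by
  simp only [det3_eq]; ring

theorem det3_self_right (u v : Fin 3 → ℝ) : det3 u v v = 0 := by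
  simp only [det3_eq]; ring

theorem det3_self_outer (u v : Fin 3 → ℝ) : det3 u v u = 0 := by
  simp only [det3_eq]; ring

theorem exists_relation_of_det3_eq_zero {u v w : Fin 3 → ℝ} (h : det3 u v w = 0) :
    ∃ α β γ : ℝ, (α ≠ 0 ∨ β ≠ 0 ∨ γ ≠ 0) ∧ α • u + β • v + γ • w = 0 := by
  obtain ⟨x, hx, hx0⟩ := Matrix.exists_mulVec_eq_zero_iff.2 h
  refine ⟨x 0, x 1, x 2, ?_, ?_⟩
  · by_contra! hc
    apply hx
    ext i
    fin_cases i <;> simp [hc]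
  · ext i
    have := congrFun hx0 i
    simp only [Matrix.mulVec, dotProduct, Fin.sum_univ_three] at this
    simp at this ⊢
    linarith

namespace IsConvexPolygonWithVertices

variable {n : ℕ} {P : Set (Fin 3 → ℝ)} {v : Fin n → Fin 3 → ℝ}

theorem mem (hP : IsConvexPolygonWithVertices P v) (i : Fin n) : v i ∈ P :=
  hP.eq_convexHull ▸ subset_convexHull ℝ _ (Set.mem_range_self i)

/-- The plane of the polygon, normalized to height one. -/
theorem exists_height (hP : IsConvexPolygonWithVertices P v) :
    ∃ ℓ : (Fin 3 → ℝ) →ₗ[ℝ] ℝ, ∀ i, ℓ (v i) = 1 := by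
  obtain ⟨ℓ, c, hc, h⟩ := hP.exists_plane
  exact ⟨c⁻¹ • ℓ, fun i => by simp [h _ (hP.mem i), hc]⟩

theorem convex_diff (hP : IsConvexPolygonWithVertices P v) (d : Fin n) :
    Convex ℝ (P \ {v d}) := by
  have hc : Convex ℝ P := hP.eq_convexHull ▸ convex_convexHull ℝ _
  have : v d ∈ Set.extremePoints ℝ P := hP.extremePoints_eq ▸ Set.mem_range_self d
  exact (hc.mem_extremePoints_iff_convex_sdiff.1 this).2

theorem mem_diff (hP : IsConvexPolygonWithVertices P v) {a d : Fin n} (h : a ≠ d) :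
    v a ∈ P \ {v d} :=
  ⟨hP.mem a, fun h' => h (hP.injective h')⟩

/-- No vertex is a positive multiple of a nonnegative combination of three other vertices. The
height forces `α + β + γ = δ`, so that such a relation would be a convex combination. -/
theorem combination_ne (hP : IsConvexPolygonWithVertices P v) {a b c d : Fin n} (ha : a ≠ d)
    (hb : b ≠ d) (hc : c ≠ d) {α β γ δ : ℝ} (hα : 0 ≤ α) (hβ : 0 ≤ β) (hγ : 0 ≤ γ) (hδ : 0 < δ) :
    α • v a + β • v b + γ • v c ≠ δ • v d := by
  intro h
  obtain ⟨ℓ, hℓ⟩ := hP.exists_height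
  have hsum : α + β + γ = δ := by simpa [hℓ] using congrArg ℓ h
  have h1 : v d = (α / δ) • v a + (β / δ) • v b + (γ / δ) • v c := by
    have : v d = δ⁻¹ • (δ • v d) := by rw [smul_smul, inv_mul_cancel₀ hδ.ne', one_smul]
    rw [this, ← h]
    simp only [smul_add, smul_smul, div_eq_inv_mul]
  have h2 := (hP.convex_diff d).sum_mem (t := Finset.univ) (w := ![α / δ, β / δ, γ / δ])
    (z := ![v a, v b, v c]) (by intro i _; fin_cases i <;> simp <;> positivity)
    (by simp [Fin.sum_univ_three]; rw [← hsum] at hδ ⊢; field_simp)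
    (by
      intro i _
      fin_cases i
      exacts [hP.mem_diff ha, hP.mem_diff hb, hP.mem_diff hc])
  simp only [Fin.sum_univ_three] at h2
  exact h2.2 h1.symm

/-- No three vertices are collinear. -/
theorem det3_ne_zero (hP : IsConvexPolygonWithVertices P v) {i j k : Fin n} (hij : i ≠ j)
    (hik : i ≠ k) (hjk : j ≠ k) : det3 (v i) (v j) (v k) ≠ 0 := by
  intro h
  obtain ⟨α, β, γ, hne, hrel⟩ := exists_relation_of_det3_eq_zero h
  obtain ⟨ℓ, hℓ⟩ := hP.exists_height
  have hsum : α + β + γ = 0 := by simpa [hℓ] using congrArg ℓ hrel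
  -- one coefficient is isolated in sign, so one vertex is a convex combination of the others
  have key : ∀ {a b c : Fin n} {x y z : ℝ}, a ≠ c → b ≠ c → x • v a + y • v b + z • v c = 0 →
      0 ≤ x → 0 ≤ y → z < 0 → False := by
    intro a b c x y z hac hbc hr hx hy hz
    refine hP.combination_ne hac hbc hac hx hy le_rfl (neg_pos.2 hz) ?_
    rw [zero_smul, add_zero, neg_smul, eq_neg_iff_add_eq_zero, hr]
  have hneg : (-α) • v i + (-β) • v j + (-γ) • v k = 0 := by
    rw [← neg_zero, ← hrel]; simp only [neg_smul]; abel
  have r1 : ∀ {x y z : ℝ}, x • v i + y • v j + z • v k = 0 → y • v j + z • v k + x • v i = 0 :=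
    fun h => by rw [← h]; abel
  have r2 : ∀ {x y z : ℝ}, x • v i + y • v j + z • v k = 0 → x • v i + z • v k + y • v j = 0 :=
    fun h => by rw [← h]; abel
  rcases lt_trichotomy α 0 with ha | ha | ha <;> rcases lt_trichotomy β 0 with hb | hb | hb <;>
    rcases lt_trichotomy γ 0 with hc | hc | hc <;>
    first
      | (exfalso; linarith)
      | exact key hik hjk hrel (by linarith) (by linarith) (by linarith)
      | exact key hij.symm hik.symm (r1 hrel) (by linarith) (by linarith) (by linarith)
      | exact key hij hjk.symm (r2 hrel) (by linarith) (by linarith) (by linarith)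
      | exact key hik hjk hneg (by linarith) (by linarith) (by linarith)
      | exact key hij.symm hik.symm (r1 hneg) (by linarith) (by linarith) (by linarith)
      | exact key hij hjk.symm (r2 hneg) (by linarith) (by linarith) (by linarith)
      | simp [ha, hb, hc] at hne

/-- A linear functional whose kernel cuts the plane of the polygon in a line that meets the polygon
in the vertex `v x` alone. -/
theorem exists_supporting (hP : IsConvexPolygonWithVertices P v) (x : Fin n) :
    ∃ m : (Fin 3 → ℝ) →ₗ[ℝ] ℝ, m (v x) = 0 ∧ ∀ i, i ≠ x → 0 < m (v i) := by
  have hx : v x ∉ convexHull ℝ (v '' {i | i ≠ x}) := fun h =>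
    (convexHull_min (by rintro _ ⟨i, hi, rfl⟩; exact hP.mem_diff hi) (hP.convex_diff x) h).2 rfl
  obtain ⟨f, u, hfx, hf⟩ := geometric_hahn_banach_point_closed (convex_convexHull ℝ _)
    ((Set.toFinite (v '' {i | i ≠ x})).isClosed_convexHull ℝ) hx
  obtain ⟨ℓ, hℓ⟩ := hP.exists_height
  refine ⟨f.toLinearMap - f (v x) • ℓ, by simp [hℓ], fun i hi => ?_⟩
  have := hf (v i) (subset_convexHull ℝ _ ⟨i, hi, rfl⟩)
  simp [hℓ]
  linarith

/-- Seen from the vertex `v x`, every other vertex has a slope `σ`, and the determinants with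
`v x` are the differences of slopes, up to positive factors. The value `m x = 0` makes the formula
hold for all indices. -/
theorem exists_slope (hP : IsConvexPolygonWithVertices P v) (x : Fin n) :
    ∃ m σ : Fin n → ℝ, m x = 0 ∧ (∀ i, i ≠ x → 0 < m i) ∧
      ∀ i j, det3 (v x) (v i) (v j) = m i * m j * (σ j - σ i) := by
  obtain ⟨m, hmx, hm⟩ := hP.exists_supporting x
  obtain ⟨o, ho⟩ : ∃ o, o ≠ x := by
    have : Nontrivial (Fin n) := Fin.nontrivial_iff_two_le.2 (by have := hP.three_le; omega)
    exact exists_ne x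
  refine ⟨fun i => m (v i), fun i => det3 (v x) (v o) (v i) / (m (v i) * m (v o)), hmx, hm,
    fun i j => ?_⟩
  rcases eq_or_ne i x with rfl | hi
  · simp [hmx, det3_self_left]
  rcases eq_or_ne j x with rfl | hj
  · simp [hmx, det3_self_outer]
  have h1 := congrArg m (det3_relation (v x) (v o) (v i) (v j))
  simp only [map_add, map_sub, map_smul, smul_eq_mul, hmx, map_zero] at h1
  have := (hm i hi).ne'; have := (hm j hj).ne'; have := (hm o ho).ne'
  field_simp
  linarith

/-- If the vertex `v x` is not listed in `S`, its neighbours `a`, `b` in the polygon spanned by `S`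
and `x` are the points of `S` of smallest and largest slope as seen from `v x`. The segment from `v x`
to any other point `s` of `S` crosses the segment `ab`, and no line through two points of `S`
separates `a` from `b`. -/
theorem support_neighbours (hP : IsConvexPolygonWithVertices P v) {S : Finset (Fin n)}
    {x : Fin n} (hx : x ∉ S) (hS : 3 ≤ S.card) :
    ∃ a ∈ S, ∃ b ∈ S, ∃ s ∈ S, ∃ A B D δ : ℝ, 0 ≤ A ∧ 0 ≤ B ∧ 0 < D ∧ 0 < δ ∧ A + B = D + δ ∧
      D • v s + δ • v x = A • v a + B • v b ∧ det3 (v s) (v a) (v b) < 0 ∧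
      0 < det3 (v x) (v a) (v b) ∧
      ∀ i ∈ S, ∀ k ∈ S, 0 ≤ det3 (v a) (v i) (v k) * det3 (v b) (v i) (v k) := by
  obtain ⟨m, σ, -, hm, hσ⟩ := hP.exists_slope x
  have hSx : ∀ i ∈ S, i ≠ x := fun i hi h => hx (h ▸ hi)
  have hSne : S.Nonempty := Finset.card_pos.1 (by omega)
  obtain ⟨a, haS, ha⟩ := S.exists_min_image σ hSne
  obtain ⟨b, hbS, hb⟩ := S.exists_max_image σ hSne
  have hax := hSx a haS
  have hbx := hSx b hbS
  have hnn : ∀ i ∈ S, ∀ j ∈ S, σ i ≤ σ j → 0 ≤ det3 (v x) (v i) (v j) := fun i hi j hj h => by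
    rw [hσ]
    exact mul_nonneg (mul_pos (hm i (hSx i hi)) (hm j (hSx j hj))).le (sub_nonneg.2 h)
  have hpos : ∀ i ∈ S, ∀ j ∈ S, i ≠ j → σ i ≤ σ j → 0 < det3 (v x) (v i) (v j) :=
    fun i hi j hj hij h =>
      lt_of_le_of_ne (hnn i hi j hj h) (hP.det3_ne_zero (hSx i hi).symm (hSx j hj).symm hij).symm
  have hab : a ≠ b := by
    rintro rfl
    obtain ⟨i, hi, hia⟩ := S.exists_mem_ne (by omega) a
    have h1 := hpos a haS i hi hia.symm (ha i hi)
    rw [hσ, le_antisymm (hb i hi) (ha i hi)] at h1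
    simp at h1
  have hD := hpos a haS b hbS hab (ha b hbS)
  -- every other point of `S` lies beyond the line `ab`, as seen from `x`
  have hrel : ∀ i, det3 (v x) (v a) (v b) • v i =
      det3 (v i) (v a) (v b) • v x + det3 (v x) (v i) (v b) • v a +
        det3 (v x) (v a) (v i) • v b := by
    intro i
    ext t
    fin_cases t <;> simp [det3_eq] <;> ring
  have hfar : ∀ i ∈ S, i ≠ a → i ≠ b → det3 (v i) (v a) (v b) < 0 := by
    intro i hi hia hib
    by_contra! h
    exact hP.combination_ne (hSx i hi).symm hia.symm hib.symm h (hnn i hi b hbS (hb i hi))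
      (hnn a haS i hi (ha i hi)) hD (hrel i).symm
  obtain ⟨s, hs⟩ : ((S.erase a).erase b).Nonempty := by
    rw [← Finset.card_pos]
    have h1 := Finset.pred_card_le_card_erase (s := S) (a := a)
    have h2 := Finset.pred_card_le_card_erase (s := S.erase a) (a := b)
    omega
  obtain ⟨hsb, hsa, hsS⟩ : s ≠ b ∧ s ≠ a ∧ s ∈ S := by simpa using hs
  have hfs := hfar s hsS hsa hsb
  obtain ⟨ℓ, hℓ⟩ := hP.exists_height
  refine ⟨a, haS, b, hbS, s, hsS, det3 (v x) (v s) (v b), det3 (v x) (v a) (v s),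
    det3 (v x) (v a) (v b), -det3 (v s) (v a) (v b), hnn s hsS b hbS (hb s hsS),
    hnn a haS s hsS (ha s hsS), hD, neg_pos.2 hfs, ?_, ?_, hfs, hD, ?_⟩
  · have := congrArg ℓ (hrel s)
    simp [hℓ] at this
    linarith
  · rw [hrel s, neg_smul]; abel
  · -- a line through two points of `S` does not separate `a` from `b`
    intro i hi k hk
    rcases eq_or_ne i a with rfl | hia
    · simp [det3_self_left]
    rcases eq_or_ne i b with rfl | hib
    · simp [det3_self_left]
    rcases eq_or_ne k a with rfl | hka
    · simp [det3_self_outer]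
    rcases eq_or_ne k b with rfl | hkb
    · simp [det3_self_outer]
    rcases eq_or_ne i k with rfl | hik
    · simp [det3_self_right]
    have hfi := hfar i hi hia hib
    have hfk := hfar k hk hka hkb
    have hr := det3_relation (v a) (v b) (v i) (v k)
    have e1 : det3 (v a) (v b) (v i) = det3 (v i) (v a) (v b) := by simp only [det3_eq]; ring
    have e2 : det3 (v a) (v b) (v k) = det3 (v k) (v a) (v b) := by simp only [det3_eq]; ring
    rw [e1, e2] at hr
    -- otherwise one of `i`, `k` would lie in the triangle formed by the other and `a`, `b`
    by_contra! hneg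
    rcases mul_neg_iff.1 hneg with ⟨h1, h2⟩ | ⟨h1, h2⟩
    · refine hP.combination_ne hka.symm hkb.symm hik (neg_nonneg.2 h2.le) h1.le
        (neg_nonneg.2 hfk.le) (neg_pos.2 hfi) ?_
      rw [← sub_eq_zero, ← neg_eq_zero, ← hr]
      simp only [neg_smul]; abel
    · refine hP.combination_ne hia.symm hib.symm hik.symm h2.le (neg_nonneg.2 h1.le)
        (neg_nonneg.2 hfi.le) (neg_pos.2 hfk) ?_
      rw [← sub_eq_zero, ← hr]
      simp only [neg_smul]; abel

end IsConvexPolygonWithVertices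

/-! ### The polarized cubic and its Hessian -/

/-- For a symmetric function of three indices that vanishes when two of them coincide, the six
orderings of the indices contribute equally to the full sum. -/
theorem sum_eq_six_mul_sum_lt {n : ℕ} (t : Fin n → Fin n → Fin n → ℝ)
    (h12 : ∀ i j k, t i j k = t j i k) (h23 : ∀ i j k, t i j k = t i k j)
    (h0 : ∀ i j, t i i j = 0) :
    ∑ i, ∑ j, ∑ k, t i j k =
      6 * ∑ i, ∑ j ∈ Finset.Ioi i, ∑ k ∈ Finset.Ioi j, t i j k := by
  set g : Fin n → Fin n → Fin n → ℝ := fun i j k => if i < j ∧ j < k then t i j k else 0 with hg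
  have hG : ∑ i, ∑ j ∈ Finset.Ioi i, ∑ k ∈ Finset.Ioi j, t i j k = ∑ i, ∑ j, ∑ k, g i j k := by
    refine Finset.sum_congr rfl fun i _ => ?_
    rw [← Finset.sum_subset (Finset.subset_univ (Finset.Ioi i))]
    · refine Finset.sum_congr rfl fun j hj => ?_
      rw [← Finset.sum_subset (Finset.subset_univ (Finset.Ioi j))]
      · refine Finset.sum_congr rfl fun k hk => ?_
        rw [hg]; simp only; rw [if_pos ⟨Finset.mem_Ioi.1 hj, Finset.mem_Ioi.1 hk⟩]
      · intro k _ hk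
        rw [hg]; simp only; rw [if_neg fun h => hk (Finset.mem_Ioi.2 h.2)]
    · intro j _ hj
      refine Finset.sum_eq_zero fun k _ => ?_
      rw [hg]; simp only; rw [if_neg fun h => hj (Finset.mem_Ioi.2 h.1)]
  have hsplit : ∀ i j k, t i j k =
      g i j k + g i k j + g j i k + g j k i + g k i j + g k j i := by
    intro i j k
    have a1 : t i k j = t i j k := h23 i k j
    have a2 : t j i k = t i j k := h12 j i k
    have a3 : t j k i = t i j k := (h23 j k i).trans a2
    have a4 : t k i j = t i j k := (h12 k i j).trans a1
    have a5 : t k j i = t i j k := (h12 k j i).trans a3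
    simp only [hg, a1, a2, a3, a4, a5]
    by_cases h : i = j ∨ i = k ∨ j = k
    · have : t i j k = 0 := by
        rcases h with rfl | rfl | rfl
        · exact h0 i k
        · rw [← a1]; exact h0 i j
        · rw [← a3]; exact h0 j i
      simp [this]
    · split_ifs <;> first | (exfalso; omega) | simp
  have s23 : ∀ f : Fin n → Fin n → Fin n → ℝ,
      ∑ i, ∑ j, ∑ k, f i k j = ∑ i, ∑ j, ∑ k, f i j k :=
    fun f => Finset.sum_congr rfl fun i _ => Finset.sum_comm
  have s12 : ∀ f : Fin n → Fin n → Fin n → ℝ,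
      ∑ i, ∑ j, ∑ k, f j i k = ∑ i, ∑ j, ∑ k, f i j k := fun f => Finset.sum_comm
  have s1 := s23 g
  have s2 := s12 g
  have s3 : ∑ i, ∑ j, ∑ k, g j k i = ∑ i, ∑ j, ∑ k, g i j k :=
    (s12 fun i j k => g i k j).trans s1
  have s4 : ∑ i, ∑ j, ∑ k, g k i j = ∑ i, ∑ j, ∑ k, g i j k :=
    (s23 fun i j k => g j i k).trans s2
  have s5 : ∑ i, ∑ j, ∑ k, g k j i = ∑ i, ∑ j, ∑ k, g i j k :=
    (s12 fun i j k => g k i j).trans s4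
  rw [hG, Finset.sum_congr rfl fun i _ => Finset.sum_congr rfl fun j _ =>
    Finset.sum_congr rfl fun k _ => hsplit i j k]
  simp only [Finset.sum_add_distrib]
  rw [s1, s2, s3, s4, s5]; ring

/-- The polarization of the cubic: the symmetric trilinear form with
`cubicF v φ = polarF v φ φ φ / 6`. -/
def polarF {n : ℕ} (v : Fin n → Fin 3 → ℝ) (x y z : Fin n → ℝ) : ℝ :=
  ∑ i, ∑ j, ∑ k, |det3 (v i) (v j) (v k)| * x i * y j * z k

section
variable {n : ℕ} (v : Fin n → Fin 3 → ℝ)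

theorem abs_det3_swap_left (u v w : Fin 3 → ℝ) : |det3 v u w| = |det3 u v w| := by
  rw [det3_swap_left, abs_neg]

theorem abs_det3_swap_right (u v w : Fin 3 → ℝ) : |det3 u w v| = |det3 u v w| := by
  rw [det3_swap_right, abs_neg]

theorem polarF_swap_left (x y z : Fin n → ℝ) : polarF v y x z = polarF v x y z := by
  unfold polarF
  rw [Finset.sum_comm]
  refine Finset.sum_congr rfl fun i _ => Finset.sum_congr rfl fun j _ =>
    Finset.sum_congr rfl fun k _ => ?_
  rw [abs_det3_swap_left]; ring

theorem polarF_swap_right (x y z : Fin n → ℝ) : polarF v x z y = polarF v x y z := by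
  unfold polarF
  refine Finset.sum_congr rfl fun i _ => ?_
  rw [Finset.sum_comm]
  refine Finset.sum_congr rfl fun j _ => Finset.sum_congr rfl fun k _ => ?_
  rw [abs_det3_swap_right]; ring

theorem polarF_add (x y z z' : Fin n → ℝ) :
    polarF v x y (z + z') = polarF v x y z + polarF v x y z' := by
  simp only [polarF, Pi.add_apply, mul_add, Finset.sum_add_distrib]

theorem polarF_smul (x y z : Fin n → ℝ) (t : ℝ) :
    polarF v x y (t • z) = t * polarF v x y z := by
  simp only [polarF, Pi.smul_apply, smul_eq_mul, Finset.mul_sum]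
  refine Finset.sum_congr rfl fun i _ => Finset.sum_congr rfl fun j _ =>
    Finset.sum_congr rfl fun k _ => by ring

theorem cubicF_eq_polarF (φ : Fin n → ℝ) : cubicF v φ = polarF v φ φ φ / 6 := by
  have := sum_eq_six_mul_sum_lt (fun i j k => |det3 (v i) (v j) (v k)| * φ i * φ j * φ k)
    (fun i j k => by rw [abs_det3_swap_left]; ring)
    (fun i j k => by rw [abs_det3_swap_right]; ring)
    (fun i j => by simp [det3_self_left])
  unfold polarF cubicF
  rw [this]; ring

theorem polarF_add_left (x x' y z : Fin n → ℝ) :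
    polarF v (x + x') y z = polarF v x y z + polarF v x' y z := by
  simp only [polarF, Pi.add_apply, mul_add, add_mul, Finset.sum_add_distrib]

theorem polarF_add_mid (x y y' z : Fin n → ℝ) :
    polarF v x (y + y') z = polarF v x y z + polarF v x y' z := by
  simp only [polarF, Pi.add_apply, mul_add, add_mul, Finset.sum_add_distrib]

theorem polarF_smul_left (x y z : Fin n → ℝ) (t : ℝ) :
    polarF v (t • x) y z = t * polarF v x y z := by
  rw [← polarF_swap_left, ← polarF_swap_right, polarF_smul, polarF_swap_right, polarF_swap_left]

theorem polarF_smul_mid (x y z : Fin n → ℝ) (t : ℝ) :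
    polarF v x (t • y) z = t * polarF v x y z := by
  rw [← polarF_swap_right, polarF_smul, polarF_swap_right]

theorem cubicF_add_smul (φ w : Fin n → ℝ) (t : ℝ) :
    cubicF v (φ + t • w) = cubicF v φ + (t * (3 * polarF v φ φ w) +
      t ^ 2 * (3 * polarF v φ w w) + t ^ 3 * polarF v w w w) / 6 := by
  simp only [cubicF_eq_polarF, polarF_add, polarF_add_left, polarF_add_mid, polarF_smul,
    polarF_smul_left, polarF_smul_mid]
  have e1 := polarF_swap_right v φ φ w
  have e2 := polarF_swap_left v w φ φ
  have e3 := polarF_swap_left v w φ w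
  have e4 := polarF_swap_right v w φ w
  rw [e1, ← e2, e1, ← e3, e4, ← e3]; ring

/-- The slice of the trilinear form at `i`; it is the Hessian of the partial derivative
`∂ᵢ F`. -/
def sliceF (i : Fin n) : Matrix (Fin n) (Fin n) ℝ :=
  Matrix.of fun j k => |det3 (v i) (v j) (v k)|

/-- The Hessian of the cubic at `φ`, that is, the form `polarF v φ`. -/
def hessF (φ : Fin n → ℝ) : Matrix (Fin n) (Fin n) ℝ :=
  Matrix.of fun j k => ∑ i, |det3 (v i) (v j) (v k)| * φ i

theorem polarF_eq_sum_slice (x y z : Fin n → ℝ) :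
    polarF v x y z = ∑ i, x i * (y ⬝ᵥ sliceF v i *ᵥ z) := by
  simp only [polarF, sliceF, dotProduct, Matrix.mulVec, Matrix.of_apply, Finset.mul_sum]
  exact Finset.sum_congr rfl fun i _ => Finset.sum_congr rfl fun j _ =>
    Finset.sum_congr rfl fun k _ => by ring

theorem hessF_mulVec (φ w : Fin n → ℝ) (i : Fin n) :
    (hessF v φ *ᵥ w) i = φ ⬝ᵥ sliceF v i *ᵥ w := by
  simp only [hessF, sliceF, dotProduct, Matrix.mulVec, Matrix.of_apply, Finset.mul_sum,
    Finset.sum_mul]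
  rw [Finset.sum_comm]
  refine Finset.sum_congr rfl fun j _ => Finset.sum_congr rfl fun k _ => ?_
  rw [abs_det3_swap_left]; ring

theorem polarF_eq_hessF (φ x y : Fin n → ℝ) : polarF v φ x y = x ⬝ᵥ hessF v φ *ᵥ y := by
  rw [← polarF_swap_left, polarF_eq_sum_slice, dotProduct]
  simp only [hessF_mulVec]
end

namespace IsConvexPolygonWithVertices

variable {n : ℕ} {P : Set (Fin 3 → ℝ)} {v : Fin n → Fin 3 → ℝ}

theorem exists_ne_ne (hP : IsConvexPolygonWithVertices P v) (i j : Fin n) :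
    ∃ k, k ≠ i ∧ k ≠ j := by
  have : ({i, j} : Finset (Fin n)).card < (Finset.univ : Finset (Fin n)).card := by
    have h1 := Finset.card_le_two (a := i) (b := j)
    have := hP.three_le
    rw [Finset.card_univ, Fintype.card_fin]; omega
  obtain ⟨k, -, hk⟩ := Finset.exists_mem_notMem_of_card_lt_card this
  exact ⟨k, by simpa using hk⟩

theorem hessF_pos (hP : IsConvexPolygonWithVertices P v) {φ : Fin n → ℝ} (hφ : ∀ i, 0 < φ i)
    {i j : Fin n} (hij : i ≠ j) : 0 < hessF v φ i j := by
  obtain ⟨k, hki, hkj⟩ := hP.exists_ne_ne i j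
  change 0 < ∑ l, |det3 (v l) (v i) (v j)| * φ l
  exact Finset.sum_pos' (fun l _ => mul_nonneg (abs_nonneg _) (hφ l).le)
    ⟨k, Finset.mem_univ _, mul_pos (abs_pos.2 (hP.det3_ne_zero hki hkj hij)) (hφ k)⟩

theorem hessF_nonneg {φ : Fin n → ℝ} (hφ : ∀ i, 0 < φ i) (i j : Fin n) :
    0 ≤ hessF v φ i j := by
  change 0 ≤ ∑ l, |det3 (v l) (v i) (v j)| * φ l
  exact Finset.sum_nonneg fun l _ => mul_nonneg (abs_nonneg _) (hφ l).le

theorem hessF_mulVec_pos (hP : IsConvexPolygonWithVertices P v) {φ : Fin n → ℝ}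
    (hφ : ∀ i, 0 < φ i) (i : Fin n) : 0 < (hessF v φ *ᵥ φ) i := by
  obtain ⟨k, hki, -⟩ := hP.exists_ne_ne i i
  exact Finset.sum_pos' (fun l _ => mul_nonneg (hessF_nonneg hφ i l) (hφ l).le)
    ⟨k, Finset.mem_univ _, mul_pos (hP.hessF_pos hφ hki.symm) (hφ k)⟩

theorem polarF_pos (hP : IsConvexPolygonWithVertices P v) {φ : Fin n → ℝ}
    (hφ : ∀ i, 0 < φ i) : 0 < polarF v φ φ φ := by
  rw [polarF_eq_hessF]
  exact Finset.sum_pos (fun i _ => mul_pos (hφ i) (hP.hessF_mulVec_pos hφ i))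
    ⟨⟨0, by have := hP.three_le; omega⟩, Finset.mem_univ _⟩

/-- The slice at `x` is the area form of a zonogon, the projection along `v x`. -/
theorem exists_slice_eq (hP : IsConvexPolygonWithVertices P v) (x : Fin n) :
    ∃ c σ : Fin n → ℝ, (∀ i, 0 ≤ c i) ∧ (∀ i, i ≠ x → c i ≠ 0) ∧ Set.InjOn σ {i | c i ≠ 0} ∧
      ∀ i j, sliceF v x i j = c i * c j * |σ i - σ j| := by
  obtain ⟨m, σ, hmx, hm, hσ⟩ := hP.exists_slope x
  have hm0 : ∀ i, 0 ≤ m i := fun i => by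
    rcases eq_or_ne i x with rfl | h
    exacts [hmx.ge, (hm i h).le]
  refine ⟨m, σ, hm0, fun i hi => (hm i hi).ne', fun i hi j hj hij => ?_, fun i j => ?_⟩
  · by_contra hne
    have hix : i ≠ x := by rintro rfl; exact hi hmx
    have hjx : j ≠ x := by rintro rfl; exact hj hmx
    exact hP.det3_ne_zero hix.symm hjx.symm hne (by rw [hσ, hij]; simp)
  · rw [sliceF, Matrix.of_apply, hσ, abs_mul, abs_of_nonneg (mul_nonneg (hm0 i) (hm0 j)),
      abs_sub_comm]

/-- Strict Alexandrov–Fenchel inequality for the trilinear form, in its infinitesimal form. -/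
theorem polarF_neg (hP : IsConvexPolygonWithVertices P v) {φ w : Fin n → ℝ}
    (hφ : ∀ i, 0 < φ i) (hw : polarF v φ φ w = 0) (hw0 : w ≠ 0) : polarF v φ w w < 0 := by
  have : Nonempty (Fin n) := ⟨⟨0, by have := hP.three_le; omega⟩⟩
  have hp : ∀ i, 0 < φ ⬝ᵥ sliceF v i *ᵥ φ := fun i =>
    hessF_mulVec v φ φ i ▸ hP.hessF_mulVec_pos hφ i
  have hsum : ∀ w, w ⬝ᵥ hessF v φ *ᵥ w = ∑ i, φ i * (w ⬝ᵥ sliceF v i *ᵥ w) := fun w => by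
    rw [← polarF_eq_hessF, polarF_eq_sum_slice]
  rw [polarF_eq_hessF] at hw ⊢
  refine neg_def_of_bochner (fun i j => ?_) (fun i => hessF_nonneg hφ i i)
    (fun i j h => hP.hessF_pos hφ h) hφ (hP.hessF_mulVec_pos hφ) (fun w => ?_) (fun w hw => ?_)
    hw hw0
  · simp only [hessF, Matrix.of_apply]
    exact Finset.sum_congr rfl fun k _ => by rw [abs_det3_swap_right]
  · rw [hsum]
    refine Finset.sum_le_sum fun i _ => ?_
    obtain ⟨c, σ, hc, -, hσ, hA⟩ := hP.exists_slice_eq i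
    have h1 := reverse_cauchy_schwarz_of_abs_sub hc hσ hA hφ (hp i) w
    rw [hessF_mulVec, hessF_mulVec]
    calc _ ≤ φ i * _ := mul_le_mul_of_nonneg_left h1 (hφ i).le
      _ = _ := by ring
  · have h1 : ∀ i, φ ⬝ᵥ sliceF v i *ᵥ w = 0 := fun i => by rw [← hessF_mulVec, hw]; rfl
    have h2 : ∀ i, w ⬝ᵥ sliceF v i *ᵥ w ≤ 0 ∧
        (w ⬝ᵥ sliceF v i *ᵥ w = 0 → ∀ j, j ≠ i → w j = 0) := fun i => by
      obtain ⟨c, σ, hc, hc0, hσ, hA⟩ := hP.exists_slice_eq i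
      obtain ⟨h3, h4⟩ := lorentzian_of_abs_sub hc hσ hA hφ (hp i) (h1 i)
      exact ⟨h3, fun h j hj => h4 h j (hc0 j hj)⟩
    have h3 := hsum w
    rw [hw, dotProduct_zero] at h3
    have h4 := (Finset.sum_eq_zero_iff_of_nonpos fun i _ =>
      mul_nonpos_of_nonneg_of_nonpos (hφ i).le (h2 i).1).1 h3.symm
    ext j
    obtain ⟨i, hi, -⟩ := hP.exists_ne_ne j j
    refine (h2 i).2 ?_ j hi.symm
    simpa [(hφ i).ne'] using h4 i (Finset.mem_univ _)

/-- If both points were stationary and distinct, `polarF v φ ψ ψ < polarF v φ φ φ` would hold with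
`polarF v φ φ φ = polarF v φ φ ψ`, and the same with `φ` and `ψ` exchanged. -/
theorem eq_of_stationary (hP : IsConvexPolygonWithVertices P v) {φ ψ : Fin n → ℝ}
    (hφ : ∀ i, 0 < φ i) (hψ : ∀ i, 0 < ψ i) (h1 : polarF v φ φ (ψ - φ) = 0)
    (h2 : polarF v ψ ψ (φ - ψ) = 0) : ψ = φ := by
  by_contra hne
  have hlt : ∀ {φ ψ : Fin n → ℝ}, (∀ i, 0 < φ i) → polarF v φ φ (ψ - φ) = 0 → ψ ≠ φ →
      polarF v φ φ ψ = polarF v φ φ φ ∧ polarF v φ ψ ψ < polarF v φ φ φ := by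
    intro φ ψ hφ h hne
    have a := hP.polarF_neg hφ h (sub_ne_zero.2 hne)
    have e : ψ - φ = ψ + (-1 : ℝ) • φ := by ext i; simp; ring
    rw [e] at h a
    simp only [polarF_add, polarF_add_mid, polarF_smul, polarF_smul_mid,
      polarF_swap_right v φ φ ψ] at h a
    constructor <;> linarith
  obtain ⟨a1, a2⟩ := hlt hφ h1 hne
  obtain ⟨b1, b2⟩ := hlt hψ h2 (Ne.symm hne)
  rw [polarF_swap_left, polarF_swap_right] at a2 b2
  have c1 : polarF v ψ ψ φ = polarF v φ ψ ψ := by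
    rw [← polarF_swap_right, polarF_swap_left]
  have c2 : polarF v φ φ ψ = polarF v ψ φ φ := by
    rw [← polarF_swap_right, polarF_swap_left]
  have d1 : polarF v ψ φ ψ = polarF v φ ψ ψ := polarF_swap_left ..
  have d2 : polarF v φ ψ φ = polarF v ψ φ φ := polarF_swap_left ..
  linarith

end IsConvexPolygonWithVertices

/-! ### Critical points and maximum points on the simplex -/

section
variable {n : ℕ}

theorem sum_eq_zero_of_mem_direction {r : ℝ} {w : Fin n → ℝ}
    (hw : w ∈ (affineSpan ℝ (simplexGamma n r)).direction) : ∑ i, w i = 0 := by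
  rw [direction_affineSpan, vectorSpan_def] at hw
  have hle : Submodule.span ℝ (simplexGamma n r -ᵥ simplexGamma n r) ≤
      LinearMap.ker (∑ i, LinearMap.proj i : (Fin n → ℝ) →ₗ[ℝ] ℝ) := by
    rw [Submodule.span_le]
    rintro _ ⟨x, hx, y, hy, rfl⟩
    simp [hx.2, hy.2]
  simpa using hle hw

theorem sub_mem_direction {r : ℝ} {φ ψ : Fin n → ℝ} (hφ : φ ∈ simplexGamma n r)
    (hψ : ψ ∈ simplexGamma n r) : ψ - φ ∈ (affineSpan ℝ (simplexGamma n r)).direction :=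
  AffineSubspace.vsub_mem_direction (subset_affineSpan ℝ _ hψ) (subset_affineSpan ℝ _ hφ)

theorem const_mem_simplexGamma (hn : 0 < n) {r : ℝ} (hr : 0 < r) :
    (fun _ => r / n) ∈ simplexGamma n r := by
  refine ⟨fun _ => by positivity, ?_⟩
  simp; field_simp

theorem mem_intrinsicInterior_simplexGamma (hn : 0 < n) {r : ℝ} (hr : 0 < r) (φ : Fin n → ℝ) :
    φ ∈ intrinsicInterior ℝ (simplexGamma n r) ↔ φ ∈ simplexGamma n r ∧ ∀ i, 0 < φ i := by
  rw [mem_intrinsicInterior]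
  constructor
  · rintro ⟨y, hy, rfl⟩
    have hyG : y ∈ ((↑) ⁻¹' simplexGamma n r : Set (affineSpan ℝ (simplexGamma n r))) :=
      interior_subset hy
    change (y : Fin n → ℝ) ∈ simplexGamma n r at hyG
    refine ⟨hyG, fun i => lt_of_le_of_ne (hyG.1 i) fun h0 => ?_⟩
    -- moving away from the barycentre would leave the simplex through the face `φ i = 0`
    set c : Fin n → ℝ := fun _ => r / n with hc
    have hcG : c ∈ affineSpan ℝ (simplexGamma n r) :=
      subset_affineSpan ℝ _ (const_mem_simplexGamma hn hr)
    set g : ℝ → affineSpan ℝ (simplexGamma n r) := fun t =>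
      ⟨AffineMap.lineMap (y : Fin n → ℝ) c t, AffineMap.lineMap_mem t y.2 hcG⟩ with hg
    have hg0 : g 0 = y := Subtype.ext (AffineMap.lineMap_apply_zero _ _)
    have hgc : Continuous g := AffineMap.lineMap_continuous.subtype_mk _
    have hev : ∀ᶠ t in nhds (0 : ℝ), g t ∈
        interior ((↑) ⁻¹' simplexGamma n r : Set (affineSpan ℝ (simplexGamma n r))) :=
      hgc.continuousAt.eventually_mem (by rw [hg0]; exact isOpen_interior.mem_nhds hy)
    obtain ⟨t, ht, ht0⟩ := ((hev.filter_mono nhdsWithin_le_nhds).and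
      (self_mem_nhdsWithin : ∀ᶠ t in nhdsWithin (0 : ℝ) (Set.Iio 0), t ∈ Set.Iio 0)).exists
    have ht' : g t ∈ ((↑) ⁻¹' simplexGamma n r : Set (affineSpan ℝ (simplexGamma n r))) :=
      interior_subset ht
    have h1 : 0 ≤ (g t : Fin n → ℝ) i := ht'.1 i
    have h2 : (g t : Fin n → ℝ) i = t * (r / n) := by
      simp [hg, hc, AffineMap.lineMap_apply, ← h0]
    rw [h2] at h1
    have : 0 < r / n := by positivity
    exact absurd h1 (not_le.2 (mul_neg_of_neg_of_pos ht0 this))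
  · rintro ⟨hφ, hpos⟩
    refine ⟨⟨φ, subset_affineSpan ℝ _ hφ⟩, ?_, rfl⟩
    rw [mem_interior]
    refine ⟨{y | ∀ i, 0 < (y : Fin n → ℝ) i}, fun y hy => ⟨fun i => (hy i).le, ?_⟩, ?_, hpos⟩
    · have h1 : (y : Fin n → ℝ) - φ ∈ (affineSpan ℝ (simplexGamma n r)).direction :=
        AffineSubspace.vsub_mem_direction y.2 (subset_affineSpan ℝ _ hφ)
      have h2 := sum_eq_zero_of_mem_direction h1
      simp only [Pi.sub_apply, Finset.sum_sub_distrib, hφ.2] at h2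
      linarith
    · simp only [Set.ofPred_forall]
      exact isOpen_iInter_of_finite fun i =>
        isOpen_lt continuous_const ((continuous_apply i).comp continuous_subtype_val)

theorem differentiable_cubicF (v : Fin n → Fin 3 → ℝ) : Differentiable ℝ (cubicF v) := by
  unfold cubicF
  fun_prop

theorem HasFDerivAt.cubicF_apply {v : Fin n → Fin 3 → ℝ} {φ : Fin n → ℝ}
    {f' : (Fin n → ℝ) →L[ℝ] ℝ} (h : HasFDerivAt (cubicF v) f' φ) (w : Fin n → ℝ) :
    f' w = polarF v φ φ w / 2 := by
  have h1 : HasDerivAt (fun t : ℝ => cubicF v (φ + t • w)) (f' w) 0 := h.hasLineDerivAt w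
  have h2 : HasDerivAt (fun t : ℝ => cubicF v (φ + t • w)) (polarF v φ φ w / 2) 0 := by
    simp only [cubicF_add_smul]
    have h3 := ((((hasDerivAt_id (0 : ℝ)).mul_const (3 * polarF v φ φ w)).add
      ((hasDerivAt_pow 2 (0 : ℝ)).mul_const (3 * polarF v φ w w))).add
      ((hasDerivAt_pow 3 (0 : ℝ)).mul_const (polarF v w w w))).div_const 6
    refine (h3.const_add (cubicF v φ)).congr_deriv ?_
    simp; ring
  exact h1.unique h2

theorem isCriticalPointInRelint_cubicF_iff (hn : 0 < n) {r : ℝ} (hr : 0 < r)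
    (v : Fin n → Fin 3 → ℝ) (φ : Fin n → ℝ) :
    IsCriticalPointInRelint (cubicF v) (simplexGamma n r) φ ↔
      φ ∈ simplexGamma n r ∧ (∀ i, 0 < φ i) ∧
        ∀ w ∈ (affineSpan ℝ (simplexGamma n r)).direction, polarF v φ φ w = 0 := by
  rw [IsCriticalPointInRelint, mem_intrinsicInterior_simplexGamma hn hr, and_assoc]
  refine and_congr_right fun _ => and_congr_right fun _ => ⟨?_, fun h => ?_⟩
  · rintro ⟨f', hf, h0⟩ w hw
    have := hf.cubicF_apply w
    rw [h0 w hw] at this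
    linarith
  · have hf := (differentiable_cubicF v φ).hasFDerivAt
    exact ⟨_, hf, fun w hw => by rw [hf.cubicF_apply w, h w hw, zero_div]⟩

theorem convex_simplexGamma (n : ℕ) (r : ℝ) : Convex ℝ (simplexGamma n r) := by
  rintro x ⟨hx, hxs⟩ y ⟨hy, hys⟩ a b ha hb hab
  refine ⟨fun i => ?_, ?_⟩
  · have := hx i; have := hy i
    simp only [Pi.add_apply, Pi.smul_apply, smul_eq_mul]; positivity
  · simp only [Pi.add_apply, Pi.smul_apply, smul_eq_mul, Finset.sum_add_distrib,
      ← Finset.mul_sum, hxs, hys]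
    rw [← add_mul, hab, one_mul]

theorem isCompact_simplexGamma (n : ℕ) (r : ℝ) : IsCompact (simplexGamma n r) := by
  refine (isCompact_Icc (a := fun _ : Fin n => (0 : ℝ)) (b := fun _ => r)).of_isClosed_subset ?_ ?_
  · have : simplexGamma n r = (⋂ i, {φ | 0 ≤ φ i}) ∩ {φ | ∑ i, φ i = r} := by
      ext; simp [simplexGamma]
    rw [this]
    exact (isClosed_iInter fun i => isClosed_le continuous_const (continuous_apply i)).inter
      (isClosed_eq (by fun_prop) continuous_const)
  · rintro φ ⟨h0, hs⟩
    exact ⟨fun i => h0 i, fun i => hs ▸ Finset.single_le_sum (fun j _ => h0 j) (Finset.mem_univ i)⟩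

/-- The first-order condition: the derivative towards any point of the simplex is nonpositive. -/
theorem polarF_le_of_isMaxOn {r : ℝ} {v : Fin n → Fin 3 → ℝ} {φ ψ : Fin n → ℝ}
    (hφ : φ ∈ simplexGamma n r) (hmax : IsMaxOn (cubicF v) (simplexGamma n r) φ)
    (hψ : ψ ∈ simplexGamma n r) : polarF v φ φ ψ ≤ polarF v φ φ φ := by
  have e : ψ = φ + (ψ - φ) := by abel
  rw [e, polarF_add]
  by_contra! hc
  set w := ψ - φ
  have ha : 0 < polarF v φ φ w := by linarith
  set a := polarF v φ φ w
  set b := polarF v φ w w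
  set c := polarF v w w w
  set B := 3 * |b| + |c| with hB
  have hB0 : 0 ≤ B := by positivity
  -- for this `t` the linear term exceeds the quadratic and cubic terms
  set t := a / (a + B) with ht
  have ht0 : 0 < t := by positivity
  have ht1 : t ≤ 1 := by rw [ht, div_le_one (by positivity)]; linarith
  have hmem : φ + t • w ∈ simplexGamma n r :=
    (convex_simplexGamma n r).add_smul_sub_mem hφ hψ ⟨ht0.le, ht1⟩
  have h1 := hmax hmem
  simp only [Set.mem_ofPred_eq, cubicF_add_smul] at h1
  have h2 : t * (3 * a + (3 * (t * b) + t ^ 2 * c)) ≤ 0 := by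
    change cubicF v φ + (t * (3 * a) + t ^ 2 * (3 * b) + t ^ 3 * c) / 6 ≤ cubicF v φ at h1
    linarith
  have h3 : 3 * a + (3 * (t * b) + t ^ 2 * c) ≤ 0 := by
    by_contra! h
    linarith [mul_pos ht0 h]
  have h4 : -(t * |b|) ≤ t * b := by
    rw [← mul_neg]; exact mul_le_mul_of_nonneg_left (neg_abs_le b) ht0.le
  have h5 : -(t * |c|) ≤ t ^ 2 * c := by
    have h6 : -(t ^ 2 * |c|) ≤ t ^ 2 * c := by
      rw [← mul_neg]; exact mul_le_mul_of_nonneg_left (neg_abs_le c) (sq_nonneg t)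
    have h7 : t ^ 2 * |c| ≤ t * |c| :=
      mul_le_mul_of_nonneg_right (by nlinarith) (abs_nonneg c)
    linarith
  have h8 : t * (a + B) = a := by rw [ht]; field_simp
  have h9 : t * B = 3 * (t * |b|) + t * |c| := by rw [hB]; ring
  have h10 := mul_pos ht0 ha
  linarith

/-- Twice the gradient of the cubic at `φ`; the factor avoids denominators. -/
def gradF (v : Fin n → Fin 3 → ℝ) (φ : Fin n → ℝ) (i : Fin n) : ℝ :=
  ∑ j, ∑ k, |det3 (v i) (v j) (v k)| * φ j * φ k

theorem polarF_eq_sum_gradF (v : Fin n → Fin 3 → ℝ) (φ ψ : Fin n → ℝ) :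
    polarF v φ φ ψ = ∑ i, gradF v φ i * ψ i := by
  rw [← polarF_swap_right, ← polarF_swap_left]
  simp only [polarF, gradF, Finset.sum_mul]
  exact Finset.sum_congr rfl fun i _ => Finset.sum_congr rfl fun j _ =>
    Finset.sum_congr rfl fun k _ => by ring

/-- The Karush–Kuhn–Tucker conditions at a maximum point, from comparison with the corners of the
simplex. -/
theorem gradF_of_isMaxOn {r : ℝ} (hr : 0 < r) {v : Fin n → Fin 3 → ℝ} {φ : Fin n → ℝ}
    (hφ : φ ∈ simplexGamma n r) (hmax : IsMaxOn (cubicF v) (simplexGamma n r) φ) :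
    ∃ c : ℝ, (∀ i, gradF v φ i ≤ c) ∧ ∀ i, φ i ≠ 0 → gradF v φ i = c := by
  have hle : ∀ i, gradF v φ i ≤ polarF v φ φ φ / r := by
    intro i
    have hmem : Pi.single i r ∈ simplexGamma n r := by
      refine ⟨fun j => ?_, by simp⟩
      by_cases h : j = i
      · subst h; simp [hr.le]
      · simp [h]
    have h1 := polarF_le_of_isMaxOn hφ hmax hmem
    rw [polarF_eq_sum_gradF v φ (Pi.single i r)] at h1
    rw [le_div_iff₀ hr]
    simpa [Pi.single_apply] using h1
  refine ⟨polarF v φ φ φ / r, hle, fun i hi => ?_⟩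
  have h0 : ∑ i, (polarF v φ φ φ / r - gradF v φ i) * φ i = 0 := by
    simp only [sub_mul, Finset.sum_sub_distrib, ← Finset.mul_sum, hφ.2, ← polarF_eq_sum_gradF]
    field_simp; ring
  have h1 := (Finset.sum_eq_zero_iff_of_nonneg fun i _ =>
    mul_nonneg (sub_nonneg.2 (hle i)) (hφ.1 i)).1 h0 i (Finset.mem_univ i)
  have h2 : polarF v φ φ φ / r - gradF v φ i = 0 := by simpa [hi] using h1
  linarith

end

namespace IsConvexPolygonWithVertices

variable {n : ℕ} {P : Set (Fin 3 → ℝ)} {v : Fin n → Fin 3 → ℝ}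

/-- A maximum point has no zero coordinate. If `φ x = 0`, let `a`, `b`, `s` be as in
`support_neighbours`. The gradient, extended to the function `y ↦ ∑ |det3 y (v j) (v k)| φ j φ k`, is
convex along the segment from `v s` to `v x`, linear on `ab`, and has a kink on the line `ab`. It takes
the same value at `v a`, `v b` and `v s`, and so a larger value at `v x`. -/
theorem pos_of_isMaxOn (hP : IsConvexPolygonWithVertices P v) {r : ℝ} (hr : 0 < r)
    {φ : Fin n → ℝ} (hφ : φ ∈ simplexGamma n r)
    (hmax : IsMaxOn (cubicF v) (simplexGamma n r) φ) (x : Fin n) : 0 < φ x := by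
  refine lt_of_le_of_ne (hφ.1 x) fun hx0 => ?_
  have hn : 0 < n := by have := hP.three_le; omega
  have hFpos : 0 < polarF v φ φ φ := by
    have h1 := hmax (const_mem_simplexGamma hn hr)
    simp only [Set.mem_ofPred_eq, cubicF_eq_polarF] at h1
    have := hP.polarF_pos (φ := fun _ => r / n) fun _ => by positivity
    linarith
  set S : Finset (Fin n) := Finset.univ.filter fun i => φ i ≠ 0 with hS
  have hS3 : 3 ≤ S.card := by
    obtain ⟨i, -, hi⟩ := Finset.exists_ne_zero_of_sum_ne_zero hFpos.ne'
    obtain ⟨j, -, hj⟩ := Finset.exists_ne_zero_of_sum_ne_zero hi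
    obtain ⟨k, -, hk⟩ := Finset.exists_ne_zero_of_sum_ne_zero hj
    refine Finset.two_lt_card.2 ⟨i, ?_, j, ?_, k, ?_, ?_, ?_, ?_⟩
    · rw [hS, Finset.mem_filter]; exact ⟨Finset.mem_univ _, fun h => hk (by simp [h])⟩
    · rw [hS, Finset.mem_filter]; exact ⟨Finset.mem_univ _, fun h => hk (by simp [h])⟩
    · rw [hS, Finset.mem_filter]; exact ⟨Finset.mem_univ _, fun h => hk (by simp [h])⟩
    · rintro rfl; exact hk (by simp [det3_self_left])
    · rintro rfl; exact hk (by simp [det3_self_outer])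
    · rintro rfl; exact hk (by simp [det3_self_right])
  obtain ⟨a, ha, b, hb, s, hs, A, B, D, δ, hA, hB, hD, hδ, hsum, hvec, hsab, hxab, hsame⟩ :=
    hP.support_neighbours (S := S) (x := x) (by simp [hS, ← hx0]) hS3
  obtain ⟨c, hle, heq⟩ := gradF_of_isMaxOn hr hφ hmax
  have hSc : ∀ i ∈ S, gradF v φ i = c := fun i hi => heq i (Finset.mem_filter.1 hi).2
  have hlin : ∀ i k, A * det3 (v a) (v i) (v k) + B * det3 (v b) (v i) (v k) =
      D * det3 (v s) (v i) (v k) + δ * det3 (v x) (v i) (v k) := fun i k => by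
    rw [← det3_add_smul, ← det3_add_smul, hvec]
  have hsplit : ∀ i ∈ S, ∀ k ∈ S,
      A * |det3 (v a) (v i) (v k)| + B * |det3 (v b) (v i) (v k)| =
        |A * det3 (v a) (v i) (v k) + B * det3 (v b) (v i) (v k)| := fun i hi k hk => by
    have h1 : 0 ≤ (A * det3 (v a) (v i) (v k)) * (B * det3 (v b) (v i) (v k)) := by
      rw [mul_mul_mul_comm]
      exact mul_nonneg (mul_nonneg hA hB) (hsame i hi k hk)
    have h2 := abs_add_eq_add_abs_iff (A * det3 (v a) (v i) (v k)) (B * det3 (v b) (v i) (v k))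
    rw [h2.2 (mul_nonneg_iff.1 h1), abs_mul, abs_mul, abs_of_nonneg hA, abs_of_nonneg hB]
  have hterm : ∀ i k, (A * |det3 (v a) (v i) (v k)| + B * |det3 (v b) (v i) (v k)|) * φ i * φ k ≤
      (D * |det3 (v s) (v i) (v k)| + δ * |det3 (v x) (v i) (v k)|) * φ i * φ k := fun i k => by
    by_cases hi : φ i = 0
    · simp [hi]
    by_cases hk : φ k = 0
    · simp [hk]
    refine mul_le_mul_of_nonneg_right (mul_le_mul_of_nonneg_right ?_ (hφ.1 i)) (hφ.1 k)
    rw [hsplit i (by simp [hS, hi]) k (by simp [hS, hk]), hlin]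
    refine (abs_add_le _ _).trans (le_of_eq ?_)
    rw [abs_mul, abs_mul, abs_of_pos hD, abs_of_pos hδ]
  have hstrict : (A * |det3 (v a) (v a) (v b)| + B * |det3 (v b) (v a) (v b)|) * φ a * φ b <
      (D * |det3 (v s) (v a) (v b)| + δ * |det3 (v x) (v a) (v b)|) * φ a * φ b := by
    have h1 : 0 < φ a := lt_of_le_of_ne (hφ.1 a) (Ne.symm (Finset.mem_filter.1 ha).2)
    have h2 : 0 < φ b := lt_of_le_of_ne (hφ.1 b) (Ne.symm (Finset.mem_filter.1 hb).2)
    have h3 := abs_pos.2 hxab.ne'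
    rw [det3_self_left, det3_self_outer, abs_zero, mul_zero, mul_zero, add_zero, zero_mul,
      zero_mul]
    positivity
  have hlt : A * gradF v φ a + B * gradF v φ b < D * gradF v φ s + δ * gradF v φ x := by
    have e : ∀ p q y z, p * gradF v φ y + q * gradF v φ z = ∑ i, ∑ k,
        (p * |det3 (v y) (v i) (v k)| + q * |det3 (v z) (v i) (v k)|) * φ i * φ k := by
      intro p q y z
      simp only [gradF, Finset.mul_sum, ← Finset.sum_add_distrib]
      exact Finset.sum_congr rfl fun i _ => Finset.sum_congr rfl fun k _ => by ring
    rw [e, e]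
    exact Finset.sum_lt_sum (fun i _ => Finset.sum_le_sum fun k _ => hterm i k)
      ⟨a, Finset.mem_univ _, Finset.sum_lt_sum (fun k _ => hterm a k)
        ⟨b, Finset.mem_univ _, hstrict⟩⟩
  rw [hSc a ha, hSc b hb, hSc s hs, ← add_mul, hsum, add_mul] at hlt
  have := mul_le_mul_of_nonneg_left (hle x) hδ.le
  linarith

theorem isCriticalPoint_of_isMaxOn (hP : IsConvexPolygonWithVertices P v) {r : ℝ} (hr : 0 < r)
    {φ : Fin n → ℝ} (hφ : φ ∈ simplexGamma n r)
    (hmax : IsMaxOn (cubicF v) (simplexGamma n r) φ) :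
    IsCriticalPointInRelint (cubicF v) (simplexGamma n r) φ := by
  have hpos := hP.pos_of_isMaxOn hr hφ hmax
  obtain ⟨c, -, hc⟩ := gradF_of_isMaxOn hr hφ hmax
  refine (isCriticalPointInRelint_cubicF_iff (by have := hP.three_le; omega) hr v φ).2
    ⟨hφ, hpos, fun w hw => ?_⟩
  rw [polarF_eq_sum_gradF, Finset.sum_congr rfl fun i _ => by rw [hc i (hpos i).ne'],
    ← Finset.mul_sum, sum_eq_zero_of_mem_direction hw, mul_zero]

end IsConvexPolygonWithVertices

theorem theorem1 {n : ℕ} (P : Set (Fin 3 → ℝ)) (v : Fin n → Fin 3 → ℝ)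
    (hP : IsConvexPolygonWithVertices P v) (r : ℝ) (hr : 0 < r) :
    ∃ φ : Fin n → ℝ,
      IsCriticalPointInRelint (cubicF v) (simplexGamma n r) φ ∧
      (∀ ψ : Fin n → ℝ, IsCriticalPointInRelint (cubicF v) (simplexGamma n r) ψ → ψ = φ) ∧
      (∀ ψ ∈ simplexGamma n r, ψ ≠ φ → cubicF v ψ < cubicF v φ) := by
  have hn : 0 < n := by have := hP.three_le; omega
  obtain ⟨φ, hφ, hmax⟩ := (isCompact_simplexGamma n r).exists_isMaxOn
    ⟨_, const_mem_simplexGamma hn hr⟩ (differentiable_cubicF v).continuous.continuousOn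
  have hcrit := hP.isCriticalPoint_of_isMaxOn hr hφ hmax
  have huniq : ∀ ψ : Fin n → ℝ,
      IsCriticalPointInRelint (cubicF v) (simplexGamma n r) ψ → ψ = φ := fun ψ hψ => by
    obtain ⟨-, hφ0, hφc⟩ := (isCriticalPointInRelint_cubicF_iff hn hr v φ).1 hcrit
    obtain ⟨hψG, hψ0, hψc⟩ := (isCriticalPointInRelint_cubicF_iff hn hr v ψ).1 hψ
    exact hP.eq_of_stationary hφ0 hψ0 (hφc _ (sub_mem_direction hφ hψG))
      (hψc _ (sub_mem_direction hψG hφ))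
  refine ⟨φ, hcrit, huniq, fun ψ hψ hne => lt_of_le_of_ne (hmax hψ) fun heq => hne ?_⟩
  -- a second maximum point would be a second critical point
  exact huniq ψ (hP.isCriticalPoint_of_isMaxOn hr hψ fun χ hχ => heq ▸ hmax hχ)
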